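/- **Corollary (Client Safety of Streamlined HotStuff-1).** *System.* There are $n \ge 3f+1$ replicas, of which at most $f$ are faulty (Byzantine); the others are correct and follow the protocol below. Signatures, threshold signatures and hashes are ideal: faulty replicas may send anything to anyone at any time, but cannot forge messages or signature shares of correct replicas. Communication is partially synchronous with known bound $\Delta > 0$: a message sent at time $t$ between correct replicas is delivered by $\max(t,\mathrm{GST})+\Delta$. Correct replicas process messages without delay. Views are numbered $0,1,2,\dots$; leaders $L_v$ rotate round-robin. *Blocks.* The genesis block has view $0$ and a hard-coded certificate. Any other block $B_v$ (a proposal) consists of a view $v$, a list of transactions, and a predecessor whose certificate it extends. A certificate $C_v$ of $B_v$ consists of signature shares for $B_v$ from $n-f$ distinct replicas. A block $B$ extends $A$ if $A$ lies on the chain of predecessors of $B$ and has lower view; two different blocks conflict if neither extends the other. *Protocol.* A replica starts in view $0$, with the genesis block in its global ledger and the genesis certificate as its highest known certificate. (i) A correct leader $L_v$ that has entered view $v$ and received NewView messages for view $v$ from $n-f$ replicas proposes one block once it forms a certificate of view $v-1$ from the received shares, or has NewView messages from all $n$ replicas, or its ShareTimer ($3\Delta$ after its scheduled start of view $v$) has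 expired; it does so at the latest when it has the $n-f$ NewView messages and the ShareTimer has expired. The block extends the highest certificate among its own, those in the NewView messages, and those it forms; it adopts this certificate as its highest known one and sends the proposal to all replicas. (ii) A correct replica in view $v$ that has received from $L_v$ a proposal $B_v$ containing a certificate $C_w$, $w<v$, of a block $B_w$, processes it as follows. *Commit:* if $C_w$ extends a certificate $C_{w-1}$ of view $w-1$, it appends all blocks up to $B_{w-1}$ that are not yet there to its global ledger (commits them) and responds to the clients of their transactions. *Speculation:* if $w=v-1$ (No-Gap rule) and the predecessor of $B_w$ is in its global ledger (Prefix Speculation rule), it rolls back conflicting blocks from its local ledger, speculatively executes $B_w$, adds it to the local ledger, and responds to the clients of its transactions. *Vote:* if $w$ is not lower than the view of its highest known certificate, then $C_w$ becomes its highest known certificate and it creates a share for $B_v$. It then leaves view $v$ and sends to $L_{v+1}$ a NewView message with its highest known certificate and its share, if any. (iii) On timeout it leaves view $v$ and sends to $L_{v+1}$ a NewView message with its highest known certificate and no share. A response consists of the block, the transaction, and the result of executing sequentially all transactions of the chain up to and including that transaction. *View synchronization.* The pacemaker schedules a start time $S_r(v)$ of every view $v$ at every replica $r$. There is a view $v_s$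 such that for all $v\ge v_s$ and all correct replicas $r,q$: $S_r(v)\ge\mathrm{GST}$; $q$ enters view $v$ before time $S_r(v)+2\Delta$; $q$ does not time out in view $v$ before time $S_r(v)+\tau-2\Delta$; and $q$ skips no view after $v_s$. The timer length satisfies $\tau>6\Delta$. Before $v_s$, view changes and timeouts are arbitrary. *Claim.* Consider any such execution, and suppose that a client receives matching (identical) responses, speculative or committed, from $n-f$ distinct replicas for a transaction $T$ of a block $B_v$. Then $B_v$ is eventually committed, permanently, by all correct replicas; and no correct replica ever commits a block that conflicts with $B_v$. -/

import Mathlib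

/-!
Streamlined HotStuff-1: blocks, certificates, messages, the replica's protocol steps, timed
executions with Byzantine replicas, partial synchrony, and view synchronization.
-/

namespace HotStuff1

universe u v w

/-- A proposal of a leader: the block `B_v` of transactions proposed in view `view`, together with
the proposal whose certificate it extends.  Hashes and threshold signatures are ideal, so a
certificate is identified with the proposal that it certifies, and a proposal determines the whole
chain below it.  The genesis block has view `0`, and its certificate is hard-coded. -/
inductive Block (Tx : Type u) : Type u
  | genesis : Block Tx
  | node (view : ℕ) (txs : List Tx) (parent : Block Tx) : Block Tx

namespace Block

variable {Tx : Type u}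

/-- The view in which a block is proposed. -/
def view : Block Tx → ℕ
  | genesis => 0
  | node v _ _ => v

/-- The transactions of a block. -/
def txs : Block Tx → List Tx
  | genesis => []
  | node _ ts _ => ts

/-- The predecessor of a block: the block whose certificate it extends. -/
def parent : Block Tx → Block Tx
  | genesis => genesis
  | node _ _ p => p

/-- The blocks up to and including a block, from genesis upwards. -/
def chain : Block Tx → List (Block Tx)
  | genesis => [genesis]
  | node v ts p => chain p ++ [node v ts p]

/-- All transactions up to and including those of a block, in ledger order. -/
def history : Block Tx → List Tx
  | genesis => []
  | node _ ts p => history p ++ ts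

/-- `B` extends `A`: it has a higher view, and its construction includes `A`. -/
def Extends (B A : Block Tx) : Prop := A.view < B.view ∧ A ∈ B.chain

/-- Two different blocks conflict if neither extends the other. -/
def Conflicts (A B : Block Tx) : Prop := A ≠ B ∧ ¬ A.Extends B ∧ ¬ B.Extends A

end Block

/-- Messages between replicas.  The sender is recorded by the network.
* `propose B`: the proposal `B`, carrying the certificate of `B.parent`;
* `newView v h s`: the NewView message for view `v` with the highest known certificate `h` and a
  signature share for the proposal `s` of view `v - 1` (`none` is the empty share). -/
inductive Msg (Tx : Type u) : Type u
  | propose (B : Block Tx) : Msg Tx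
  | newView (v : ℕ) (high : Block Tx) (share : Option (Block Tx)) : Msg Tx

/-- The content of a response to a client: the result of executing the transaction `tx` of
`block`.  Two responses match if their contents are equal. -/
structure Reply (Tx : Type u) (Res : Type w) where
  block : Block Tx
  tx : Tx
  res : Res

/-- The local state of a replica. -/
structure ReplicaState (Tx : Type u) (n : ℕ) where
  /-- the current view -/
  view : ℕ
  /-- `false` after leaving a view, until the pacemaker lets the replica enter the next one -/
  active : Bool
  /-- whether the replica, as a leader, has already proposed in the current view -/
  proposed : Bool
  /-- the highest known certificate; its view is `v_lp` -/
  high : Block Tx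
  /-- the committed blocks -/
  globalLedger : List (Block Tx)
  /-- the speculatively executed blocks that were not rolled back -/
  localLedger : List (Block Tx)
  /-- the messages received so far, with their senders -/
  inbox : Set (Fin n × Msg Tx)

/-- A global configuration. -/
structure Config (Tx : Type u) (Client : Type v) (Res : Type w) (n : ℕ) where
  loc : Fin n → ReplicaState Tx n
  /-- `(r, B)`: replica `r` has created its signature share for the proposal `B` -/
  signed : Set (Fin n × Block Tx)
  /-- `(s, d, m)`: the correct replica `s` has sent `m` to `d` -/
  sent : Set (Fin n × Fin n × Msg Tx)
  /-- `(r, c, p)`: the correct replica `r` has sent the response `p` to the client `c` -/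
  replies : Set (Fin n × Client × Reply Tx Res)

/-- The events of an execution. -/
inductive Action (Tx : Type u) (Client : Type v) (Res : Type w) (n : ℕ)
  /-- nothing happens -/
  | idle
  /-- replica `dst` receives the message `m` of `src` -/
  | deliver (dst src : Fin n) (m : Msg Tx)
  /-- client `c` receives the response `p` of replica `src` -/
  | clientReceive (c : Client) (src : Fin n) (p : Reply Tx Res)
  /-- the faulty replica `r` creates a signature share for `B` -/
  | faultySign (r : Fin n) (B : Block Tx)
  /-- the pacemaker lets the correct replica `r` enter view `v` -/
  | enterView (r : Fin n) (v : ℕ)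
  /-- the timer of the correct replica `r` expires in its current view -/
  | timeout (r : Fin n)
  /-- the correct replica `r`, leader of its current view, broadcasts the proposal `B` -/
  | propose (r : Fin n) (B : Block Tx)
  /-- the correct replica `r` processes the proposal `B` of its current view -/
  | handle (r : Fin n) (B : Block Tx)

variable {Tx : Type u} {Client : Type v} {Res : Type w} {n : ℕ}

/-- The leader of view `v`, in round-robin order: replica `i : Fin n` is the one whose identifier
in `{1, …, n}` is congruent to `i` modulo `n`. -/
def leader [NeZero n] (v : ℕ) : Fin n := Fin.ofNat n v

/-- A certificate for `B` exists: `n - f` replicas created signature shares for `B`. -/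
def Certified (f : ℕ) (σ : Config Tx Client Res n) (B : Block Tx) : Prop :=
  B = Block.genesis ∨ n - f ≤ {r | (r, B) ∈ σ.signed}.ncard

/-- Replica `r` has received from `s` a well-formed NewView message for the current view of `r`. -/
def HasNewView (f : ℕ) (σ : Config Tx Client Res n) (r s : Fin n) (h : Block Tx)
    (o : Option (Block Tx)) : Prop :=
  (s, Msg.newView (σ.loc r).view h o) ∈ (σ.loc r).inbox ∧
    Certified f σ h ∧ h.view < (σ.loc r).view

/-- The replicas from which `r` has received NewView messages for its current view. -/
def newViewSenders (f : ℕ) (σ : Config Tx Client Res n) (r : Fin n) : Set (Fin n) :=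
  {s | ∃ h o, HasNewView f σ r s h o}

/-- Replica `r` can form the certificate of the proposal `A` of the preceding view from `n - f`
received shares. -/
def Forms (f : ℕ) (σ : Config Tx Client Res n) (r : Fin n) (A : Block Tx) : Prop :=
  A.view + 1 = (σ.loc r).view ∧
    n - f ≤ {s | (∃ h, HasNewView f σ r s h (some A)) ∧ (s, A) ∈ σ.signed}.ncard

/-- `A` is a certificate known to `r` as a leader: its highest known one, one that it received in a
NewView message for its current view, or one that it can form. -/
def KnowsCert (f : ℕ) (σ : Config Tx Client Res n) (r : Fin n) (A : Block Tx) : Prop :=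
  A = (σ.loc r).high ∨ (∃ s o, HasNewView f σ r s A o) ∨ Forms f σ r A

/-- Replica `r` leads its current view, has not proposed in it yet, and has received `n - f`
NewView messages for it. -/
def LeaderReady [NeZero n] (f : ℕ) (σ : Config Tx Client Res n) (r : Fin n) : Prop :=
  r = leader (σ.loc r).view ∧ (σ.loc r).active = true ∧ (σ.loc r).proposed = false ∧
    n - f ≤ (newViewSenders f σ r).ncard

/-- Replica `r` is in the view of the well-formed proposal `B`, which it has received from the
leader of that view. -/
def CanHandle [NeZero n] (f : ℕ) (σ : Config Tx Client Res n) (r : Fin n) (B : Block Tx) : Prop :=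
  (σ.loc r).active = true ∧ (σ.loc r).view = B.view ∧
    (leader B.view, Msg.propose B) ∈ (σ.loc r).inbox ∧
    Certified f σ B.parent ∧ B.parent.view < B.view

/-- `Allowed … σ t a`: event `a` may happen in configuration `σ` at time `t`.  `startTime r v` is
the time at which the pacemaker of `r` schedules the start of view `v`, and the leader of view `v`
waits at most until `startTime r v + 3 Δ`.  Faulty replicas may send anything to anybody at any
time, except that they cannot forge messages or signature shares of correct replicas. -/
def Allowed [NeZero n] (f : ℕ) (faulty : Finset (Fin n)) (Δ : ℝ) (startTime : Fin n → ℕ → ℝ)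
    (σ : Config Tx Client Res n) (t : ℝ) : Action Tx Client Res n → Prop
  | .idle => True
  | .deliver _ src m => src ∈ faulty ∨ ∃ d, (src, d, m) ∈ σ.sent
  | .clientReceive c src p => src ∈ faulty ∨ (src, c, p) ∈ σ.replies
  | .faultySign r _ => r ∈ faulty
  | .enterView r v => r ∉ faulty ∧
      (((σ.loc r).view = v ∧ (σ.loc r).active = false) ∨ (σ.loc r).view < v)
  | .timeout r => r ∉ faulty ∧ (σ.loc r).active = true
  | .propose r B => r ∉ faulty ∧ LeaderReady f σ r ∧
      ((∃ A, Forms f σ r A) ∨ (newViewSenders f σ r).ncard = n ∨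
        startTime r (σ.loc r).view + 3 * Δ ≤ t) ∧
      (∃ ts P, B = Block.node (σ.loc r).view ts P) ∧
      KnowsCert f σ r B.parent ∧ ∀ A, KnowsCert f σ r A → A.view ≤ B.parent.view
  | .handle r B => r ∉ faulty ∧ CanHandle f σ r B

/-- The responses for the transactions of block `B`, each addressed to the client of the
transaction.  Execution is sequential and deterministic: `exec l` is the result of the last
transaction of `l` when the transactions `l` are executed in order. -/
def repliesFor (client : Tx → Client) (exec : List Tx → Res) (B : Block Tx) :
    Set (Client × Reply Tx Res) :=
  {x | ∃ pre T post, B.txs = pre ++ T :: post ∧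
    x = (client T, ⟨B, T, exec (B.parent.history ++ pre ++ [T])⟩)}

open Classical in
/-- The blocks that replica state `s` newly commits when it processes proposal `B`: if the
certificate of view `w` in `B` extends one of view `w - 1`, all blocks up to the latter. -/
noncomputable def newlyCommitted (s : ReplicaState Tx n) (B : Block Tx) : List (Block Tx) :=
  if B.parent.parent.view + 1 = B.parent.view then
    B.parent.parent.chain.filter (fun A => A ∉ s.globalLedger)
  else []

/-- The global ledger after processing proposal `B`. -/
noncomputable def ledgerAfter (s : ReplicaState Tx n) (B : Block Tx) : List (Block Tx) :=
  s.globalLedger ++ newlyCommitted s B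

/-- Both speculation rules hold when proposal `B` is processed: the certificate in `B` is of the
preceding view (No-Gap), and the predecessor of the certified block is in the global ledger (Prefix
Speculation). -/
def Speculates (s : ReplicaState Tx n) (B : Block Tx) : Prop :=
  B.parent.view + 1 = B.view ∧ B.parent.parent ∈ ledgerAfter s B

open Classical in
/-- The local ledger after processing proposal `B`: on speculation, everything that conflicts with
`B.parent` is rolled back, and `B.parent` is added. -/
noncomputable def localAfter (s : ReplicaState Tx n) (B : Block Tx) : List (Block Tx) :=
  if Speculates s B then
    s.localLedger.filter (fun A => A ∈ B.parent.parent.chain) ++ [B.parent]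
  else s.localLedger

/-- The replica votes for `B` if the certificate in `B` is not lower than its highest known one. -/
def Votes (s : ReplicaState Tx n) (B : Block Tx) : Prop := s.high.view ≤ B.parent.view

open Classical in
/-- The highest known certificate after processing proposal `B`. -/
noncomputable def highAfter (s : ReplicaState Tx n) (B : Block Tx) : Block Tx :=
  if Votes s B then B.parent else s.high

open Classical in
/-- The signature share in the NewView message sent after processing proposal `B`. -/
noncomputable def shareAfter (s : ReplicaState Tx n) (B : Block Tx) : Option (Block Tx) :=
  if Votes s B then some B else none

open Classical in
/-- The effect of an event.  On processing a proposal a replica commits, speculates, responds to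
the clients, votes, and leaves the view; on leaving a view it sends a NewView message to the leader
of the next view. -/
noncomputable def next [NeZero n] (client : Tx → Client) (exec : List Tx → Res)
    (σ : Config Tx Client Res n) : Action Tx Client Res n → Config Tx Client Res n
  | .idle => σ
  | .clientReceive _ _ _ => σ
  | .deliver dst src m =>
      let s := σ.loc dst
      { σ with loc := Function.update σ.loc dst { s with inbox := insert (src, m) s.inbox } }
  | .faultySign r B => { σ with signed := insert (r, B) σ.signed }
  | .enterView r v =>
      let s := σ.loc r
      { σ with
        loc := Function.update σ.loc r { s with view := v, active := true, proposed := false } }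
  | .timeout r =>
      let s := σ.loc r
      { σ with
        loc := Function.update σ.loc r { s with view := s.view + 1, active := false }
        sent := insert (r, leader (s.view + 1), Msg.newView (s.view + 1) s.high none) σ.sent }
  | .propose r B =>
      let s := σ.loc r
      { σ with
        loc := Function.update σ.loc r { s with proposed := true, high := B.parent }
        sent := σ.sent ∪ {x | ∃ d, x = (r, d, Msg.propose B)} }
  | .handle r B =>
      let s := σ.loc r
      { loc := Function.update σ.loc r
          { s with
            view := s.view + 1
            active := false
            high := highAfter s B
            globalLedger := ledgerAfter s B
            localLedger := localAfter s B }
        signed := σ.signed ∪ {x | x = (r, B) ∧ Votes s B}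
        sent := insert (r, leader (s.view + 1),
          Msg.newView (s.view + 1) (highAfter s B) (shareAfter s B)) σ.sent
        replies := σ.replies ∪ {x | x.1 = r ∧
          ((∃ A ∈ newlyCommitted s B, x.2 ∈ repliesFor client exec A) ∨
            (Speculates s B ∧ x.2 ∈ repliesFor client exec B.parent))} }

/-- The initial configuration: every replica is in the genesis view `0`, in which nothing can be
proposed, and has committed the genesis block. -/
def initial : Config Tx Client Res n where
  loc := fun _ =>
    { view := 0
      active := true
      proposed := false
      high := Block.genesis
      globalLedger := [Block.genesis]
      localLedger := []
      inbox := ∅ }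
  signed := ∅
  sent := ∅
  replies := ∅

/-- A timed execution: an infinite sequence of events, the `i`-th of which happens at time `time i`
and leads from configuration `cfg i` to `cfg (i + 1)`. -/
structure Execution [NeZero n] (f : ℕ) (faulty : Finset (Fin n)) (client : Tx → Client)
    (exec : List Tx → Res) (Δ : ℝ) where
  cfg : ℕ → Config Tx Client Res n
  act : ℕ → Action Tx Client Res n
  time : ℕ → ℝ
  /-- the view schedule of the pacemaker of each replica -/
  startTime : Fin n → ℕ → ℝ
  time_mono : Monotone time
  time_unbounded : Filter.Tendsto time Filter.atTop Filter.atTop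
  cfg_zero : cfg 0 = initial
  allowed : ∀ i, Allowed f faulty Δ startTime (cfg i) (time i) (act i)
  cfg_succ : ∀ i, cfg (i + 1) = next client exec (cfg i) (act i)
  /-- correct replicas process proposals without delay: if the `i`-th event makes it possible to
  process `B`, then this ends at the same time -/
  handle_prompt : ∀ i, ∀ r ∉ faulty, ∀ B, CanHandle f (cfg (i + 1)) r B →
    ∃ j, i ≤ j ∧ time j = time i ∧ ¬ CanHandle f (cfg (j + 1)) r B
  /-- a correct leader with `n - f` NewView messages proposes at the latest when its timer for
  collecting further ones expires, unless it leaves the view before -/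
  propose_prompt : ∀ i, ∀ r ∉ faulty, LeaderReady f (cfg (i + 1)) r →
    ∃ j, i ≤ j ∧
      time j ≤ max (time i) (startTime r ((cfg (i + 1)).loc r).view + 3 * Δ) ∧
      ¬ (LeaderReady f (cfg (j + 1)) r ∧
        ((cfg (j + 1)).loc r).view = ((cfg (i + 1)).loc r).view)

namespace Execution

variable [NeZero n] {f : ℕ} {faulty : Finset (Fin n)} {client : Tx → Client}
  {exec : List Tx → Res} {Δ : ℝ}

/-- Partial synchrony: every message between correct replicas is delivered within `Δ` of its being
sent, or of the global stabilization time `GST` if it is sent before. -/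
def PartiallySynchronous (e : Execution f faulty client exec Δ) (GST : ℝ) : Prop :=
  ∀ i, ∀ s ∉ faulty, ∀ d ∉ faulty, ∀ m, (s, d, m) ∈ (e.cfg (i + 1)).sent →
    ∃ j, e.act j = Action.deliver d s m ∧ e.time j ≤ max (e.time i) GST + Δ

/-- The views from `vs` on are synchronized, with timer length `τ`: they start after `GST`; if the
start of view `v` is scheduled at a correct replica at time `t`, with the timer of `v` expiring at
`t + τ`, then every correct replica enters view `v` before `t + 2 Δ`, and none times out in view `v`
before `t + τ - 2 Δ`; and no correct replica skips a view after `vs`. -/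
structure Synchronized (e : Execution f faulty client exec Δ) (GST τ : ℝ) (vs : ℕ) : Prop where
  after_GST : ∀ r ∉ faulty, ∀ v, vs ≤ v → GST ≤ e.startTime r v
  enter : ∀ r ∉ faulty, ∀ q ∉ faulty, ∀ v, vs ≤ v →
    ∃ i, e.act i = Action.enterView q v ∧ e.time i < e.startTime r v + 2 * Δ
  timeout : ∀ r ∉ faulty, ∀ q ∉ faulty, ∀ v, vs ≤ v → ∀ i, e.act i = Action.timeout q →
    ((e.cfg i).loc q).view = v → e.startTime r v + τ - 2 * Δ ≤ e.time i
  no_skip : ∀ r ∉ faulty, ∀ v, vs < v → ∀ i, e.act i = Action.enterView r v →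
    ((e.cfg i).loc r).view = v

/-- In the execution, client `c` receives the response `p` from replica `r`. -/
def Receives (e : Execution f faulty client exec Δ) (c : Client) (r : Fin n)
    (p : Reply Tx Res) : Prop :=
  ∃ i, e.act i = Action.clientReceive c r p

/-- At step `i`, replica `r` has committed block `B`. -/
def Committed (e : Execution f faulty client exec Δ) (i : ℕ) (r : Fin n) (B : Block Tx) : Prop :=
  B ∈ ((e.cfg i).loc r).globalLedger

end Execution

end HotStuff1

/-!
The proof has a safety half and a liveness half.

Safety. Every correct replica satisfies `ReplicaInv` in every reachable configuration. The heart of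
this invariant is the notion `Guards`: a replica guards `P` if its highest known certificate is not
lower than `P` and every proposal above `P` that it has signed extends a certificate not lower than
`P`. The voting rule preserves guards, and a replica starts to guard `P` whenever it processes a
proposal of view `P.view + 1` with the certificate of `P`: it has not signed anything above `P`
before. If a quorum guards the certified block `P`, then, by quorum intersection, every certified
block of a higher view has `P` in its chain (`locked_of_guards`). Both ways of responding to a
client lead to such a lock. A replica commits the chain of `P` on seeing a certificate `C` of the
next view extending `P`, and the signers of `C` are the guarding quorum (`Commits.locked`). A
replica that responds speculatively for `B` has, by the No-Gap rule, processed a proposal of view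
`B.view + 1` with the certificate of `B`, and so guards `B`; hence a quorum of responses either
contains one from a correct replica that has committed `B`, or locks `B`
(`exists_locked_of_receives`). Locked blocks lie on a common chain, so nothing that conflicts with
`B` is ever committed (`Locked.not_conflicts`).

Liveness. In a synchronized view `v` with a correct leader, the leader has the NewView messages of
all correct replicas when its ShareTimer expires, so it proposes within `3 Δ` of the start of the
view, and all correct replicas process the proposal within `4 Δ`, before any of them times out
(`Synchronized.exists_propose`, `Synchronized.exists_handle`). All of them vote for it, since its
certificate is not lower than any that they reported (`Synchronized.votes`), and a correct leader of
view `v + 1` then forms its certificate and extends it (`Synchronized.parent_eq`). Among `3 f + 1`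
replicas in round-robin order some three successive leaders are correct; the third of their
proposals makes all correct replicas commit the chain of the first. In high views this chain
contains every locked block, in particular the one above `B`.
-/

namespace HotStuff1

universe u v w

/-! ### Chains of blocks -/

namespace Block

variable {Tx : Type u}

theorem self_mem_chain (B : Block Tx) : B ∈ B.chain := by
  cases B <;> simp [chain]

theorem genesis_mem_chain (B : Block Tx) : genesis ∈ B.chain := by
  induction B with
  | genesis => simp [chain]
  | node v ts p ih => simp [chain, ih]

theorem mem_chain_of_mem_parent {A B : Block Tx} (h : A ∈ B.parent.chain) : A ∈ B.chain := by
  cases B with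
  | genesis => exact h
  | node v ts p => exact List.mem_append_left _ h

theorem mem_chain_trans {A B C : Block Tx} (hAB : A ∈ B.chain) (hBC : B ∈ C.chain) :
    A ∈ C.chain := by
  induction C with
  | genesis =>
    obtain rfl : B = genesis := by simpa [chain] using hBC
    exact hAB
  | node v ts p ih =>
    rcases List.mem_append.1 hBC with h | h
    · exact List.mem_append_left _ (ih h)
    · obtain rfl := List.mem_singleton.1 h
      exact hAB

/-- Views strictly increase along the chain of predecessors. -/
def WellFormed : Block Tx → Prop
  | genesis => True
  | node v _ p => p.view < v ∧ p.WellFormed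

/-- In a well-formed chain a block lies below every other block of higher or equal view. -/
theorem WellFormed.eq_or_extends {A B P : Block Tx} (hP : P.WellFormed) (hA : A ∈ P.chain)
    (hB : B ∈ P.chain) : A = B ∨ A.Extends B ∨ B.Extends A := by
  have lower : ∀ {P A : Block Tx}, P.WellFormed → A ∈ P.chain → A = P ∨ A.view < P.view := by
    intro P
    induction P with
    | genesis => intro A _ h; left; simpa [chain] using h
    | node v ts p ih =>
      intro A hw h
      rcases List.mem_append.1 h with h | h
      · right
        rcases ih hw.2 h with rfl | h'
        · exact hw.1
        · exact h'.trans hw.1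
      · exact Or.inl (List.mem_singleton.1 h)
  induction P with
  | genesis =>
    left
    rw [List.mem_singleton.1 hA, List.mem_singleton.1 hB]
  | node v ts p ih =>
    rcases List.mem_append.1 hA with hA' | hA' <;> rcases List.mem_append.1 hB with hB' | hB'
    · exact ih hP.2 hA' hB'
    · obtain rfl := List.mem_singleton.1 hB'
      rcases lower hP hA with h | h
      · exact Or.inl h
      · exact Or.inr (Or.inr ⟨h, hA⟩)
    · obtain rfl := List.mem_singleton.1 hA'
      rcases lower hP hB with h | h
      · exact Or.inl h.symm
      · exact Or.inr (Or.inl ⟨h, hB⟩)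
    · left
      rw [List.mem_singleton.1 hA', List.mem_singleton.1 hB']

end Block

/-! ### The invariant of a correct replica -/

variable {Tx : Type u} {Client : Type v} {Res : Type w} {n : ℕ}

/-- Replica `r` guards the block `P`: its highest known certificate is not lower than `P`, and
every proposal of a view above `P` that it signed extends a certificate not lower than `P`. -/
def Guards (σ : Config Tx Client Res n) (r : Fin n) (P : Block Tx) : Prop :=
  P.view ≤ (σ.loc r).high.view ∧
    ∀ A, (r, A) ∈ σ.signed → P.view < A.view → P.view ≤ A.parent.view

/-- The block `C` is certified and extends a certificate of the preceding view, so that processing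
the certificate of `C` commits the predecessor of `C`. -/
def Commits (f : ℕ) (σ : Config Tx Client Res n) (C : Block Tx) : Prop :=
  Certified f σ C ∧ C.parent.view + 1 = C.view

/-- What holds of a correct replica `r` in every reachable configuration. -/
structure ReplicaInv [NeZero n] (f : ℕ) (σ : Config Tx Client Res n) (r : Fin n) : Prop where
  signed_view : ∀ B, (r, B) ∈ σ.signed → B.view < (σ.loc r).view
  signed_parent : ∀ B, (r, B) ∈ σ.signed → B.parent.view < B.view ∧ Certified f σ B.parent
  signed_unique : ∀ A B, (r, A) ∈ σ.signed → (r, B) ∈ σ.signed → A.view = B.view → A = B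
  signed_guards : ∀ C, (r, C) ∈ σ.signed → C.parent.view + 1 = C.view → Guards σ r C.parent
  high_certified : Certified f σ (σ.loc r).high
  high_view : (σ.loc r).high.view ≤ (σ.loc r).view - 1
  newView_sent : ∀ d v h o, (r, d, Msg.newView v h o) ∈ σ.sent →
    v ≤ (σ.loc r).view ∧ h.view < v ∧ Certified f σ h ∧
      ∀ A, o = some A → (r, A) ∈ σ.signed ∧ A.view + 1 = v
  /-- In the view to which a NewView message belongs, only proposing changes the highest known
  certificate that the message carries. -/
  newView_high : ∀ d h o, (r, d, Msg.newView (σ.loc r).view h o) ∈ σ.sent →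
    (σ.loc r).high = h ∨ ∃ d B, (r, d, Msg.propose B) ∈ σ.sent ∧ B.view = (σ.loc r).view
  newView_unique : ∀ d d' v h h' o o', (r, d, Msg.newView v h o) ∈ σ.sent →
    (r, d', Msg.newView v h' o') ∈ σ.sent → h = h' ∧ o = o'
  inactive_sent : (σ.loc r).active = false →
    ∃ h o, (r, leader (σ.loc r).view, Msg.newView (σ.loc r).view h o) ∈ σ.sent
  propose_sent : ∀ d B, (r, d, Msg.propose B) ∈ σ.sent →
    r = leader B.view ∧ B.view ≤ (σ.loc r).view ∧ Certified f σ B.parent ∧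
      B.parent.view ≤ B.view - 1
  propose_current : ∀ d B, (r, d, Msg.propose B) ∈ σ.sent → B.view = (σ.loc r).view →
    (σ.loc r).active = true ∧ (σ.loc r).proposed = true ∧ (σ.loc r).high = B.parent
  propose_unique : ∀ d d' A B, (r, d, Msg.propose A) ∈ σ.sent → (r, d', Msg.propose B) ∈ σ.sent →
    A.view = B.view → A = B
  ledger : ∀ A, A ∈ (σ.loc r).globalLedger →
    A = Block.genesis ∨ ∃ C, Commits f σ C ∧ A ∈ C.parent.chain
  replies : ∀ c p, (r, c, p) ∈ σ.replies →
    (∃ C, Commits f σ C ∧ p.block ∈ C.parent.chain) ∨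
      Certified f σ p.block ∧ Guards σ r p.block

theorem Certified.mono {f : ℕ} {σ σ' : Config Tx Client Res n} (h : σ.signed ⊆ σ'.signed)
    {B : Block Tx} (hB : Certified f σ B) : Certified f σ' B := by
  rcases hB with hB | hB
  · exact Or.inl hB
  · exact Or.inr (hB.trans (Set.ncard_le_ncard (fun r hr => h hr) (Set.toFinite _)))

theorem Commits.mono {f : ℕ} {σ σ' : Config Tx Client Res n} (h : σ.signed ⊆ σ'.signed)
    {B : Block Tx} (hB : Commits f σ B) : Commits f σ' B :=
  ⟨hB.1.mono h, hB.2⟩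

/-- The parts of the configuration that belong to replica `r`, except for its inbox and its local
ledger, are the same in `σ` and `σ'`. -/
structure SameFor (r : Fin n) (σ σ' : Config Tx Client Res n) : Prop where
  view : (σ'.loc r).view = (σ.loc r).view
  active : (σ'.loc r).active = (σ.loc r).active
  proposed : (σ'.loc r).proposed = (σ.loc r).proposed
  high : (σ'.loc r).high = (σ.loc r).high
  globalLedger : (σ'.loc r).globalLedger = (σ.loc r).globalLedger
  signed : ∀ B, (r, B) ∈ σ'.signed ↔ (r, B) ∈ σ.signed
  sent : ∀ d m, (r, d, m) ∈ σ'.sent ↔ (r, d, m) ∈ σ.sent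
  replies : ∀ c p, (r, c, p) ∈ σ'.replies ↔ (r, c, p) ∈ σ.replies

theorem SameFor.guards {r : Fin n} {σ σ' : Config Tx Client Res n} (h : SameFor r σ σ')
    {P : Block Tx} : Guards σ' r P ↔ Guards σ r P := by
  simp only [Guards, h.high, h.signed]

theorem SameFor.replicaInv [NeZero n] {f : ℕ} {r : Fin n} {σ σ' : Config Tx Client Res n}
    (h : SameFor r σ σ') (hs : σ.signed ⊆ σ'.signed) (I : ReplicaInv f σ r) :
    ReplicaInv f σ' r where
  signed_view := by simpa only [h.signed, h.view] using I.signed_view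
  signed_parent := by
    simp only [h.signed]
    exact fun B hB => ⟨(I.signed_parent B hB).1, (I.signed_parent B hB).2.mono hs⟩
  signed_unique := by simpa only [h.signed] using I.signed_unique
  signed_guards := by simpa only [h.signed, h.guards] using I.signed_guards
  high_certified := by simpa only [h.high] using I.high_certified.mono hs
  high_view := by simpa only [h.high, h.view] using I.high_view
  newView_sent := by
    simp only [h.sent, h.view, h.signed]
    intro d v hi o hm
    obtain ⟨h1, h2, h3, h4⟩ := I.newView_sent d v hi o hm
    exact ⟨h1, h2, h3.mono hs, h4⟩
  newView_high := by simpa only [h.sent, h.view, h.high] using I.newView_high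
  newView_unique := by simpa only [h.sent] using I.newView_unique
  inactive_sent := by simpa only [h.sent, h.view, h.active] using I.inactive_sent
  propose_sent := by
    simp only [h.sent, h.view]
    intro d B hm
    obtain ⟨h1, h2, h3, h4⟩ := I.propose_sent d B hm
    exact ⟨h1, h2, h3.mono hs, h4⟩
  propose_current := by
    simpa only [h.sent, h.view, h.active, h.proposed, h.high] using I.propose_current
  propose_unique := by simpa only [h.sent] using I.propose_unique
  ledger := by
    simp only [h.globalLedger]
    intro A hA
    rcases I.ledger A hA with h1 | ⟨C, h1, h2⟩
    · exact Or.inl h1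
    · exact Or.inr ⟨C, h1.mono hs, h2⟩
  replies := by
    simp only [h.replies, h.guards]
    intro c p hp
    rcases I.replies c p hp with ⟨C, h1, h2⟩ | ⟨h1, h2⟩
    · exact Or.inl ⟨C, h1.mono hs, h2⟩
    · exact Or.inr ⟨h1.mono hs, h2⟩

theorem le_highAfter_view (s : ReplicaState Tx n) (B : Block Tx) :
    s.high.view ≤ (highAfter s B).view ∧ B.parent.view ≤ (highAfter s B).view := by
  unfold highAfter Votes
  split_ifs with h
  · exact ⟨h, le_rfl⟩
  · exact ⟨le_rfl, (not_le.1 h).le⟩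

theorem mem_newlyCommitted {s : ReplicaState Tx n} {A B : Block Tx} (h : A ∈ newlyCommitted s B) :
    B.parent.parent.view + 1 = B.parent.view ∧ A ∈ B.parent.parent.chain := by
  unfold newlyCommitted at h
  split_ifs at h with h'
  · exact ⟨h', (List.mem_filter.1 h).1⟩
  · simp at h

/-! ### Preservation of the invariant -/

section Step

variable [NeZero n] {f : ℕ} {faulty : Finset (Fin n)} {client : Tx → Client}
  {exec : List Tx → Res} {Δ : ℝ} {startTime : Fin n → ℕ → ℝ} {t : ℝ}

theorem KnowsCert.certified {σ : Config Tx Client Res n} {r : Fin n} {A : Block Tx}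
    (h : KnowsCert f σ r A) (I : ReplicaInv f σ r) : Certified f σ A := by
  rcases h with rfl | ⟨s, o, h⟩ | h
  · exact I.high_certified
  · exact h.2.1
  · exact Or.inr (h.2.trans (Set.ncard_le_ncard (fun s hs => hs.2) (Set.toFinite _)))

theorem KnowsCert.view_le {σ : Config Tx Client Res n} {r : Fin n} {A : Block Tx}
    (h : KnowsCert f σ r A) (I : ReplicaInv f σ r) : A.view ≤ (σ.loc r).view - 1 := by
  rcases h with rfl | ⟨s, o, h⟩ | h
  · exact I.high_view
  · have := h.2.2
    omega
  · have := h.1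
    omega

theorem signed_subset_next (σ : Config Tx Client Res n) (a : Action Tx Client Res n) :
    σ.signed ⊆ (next client exec σ a).signed := by
  cases a <;> simp [next]

/-- Signing keeps every guard, since a vote requires a certificate not lower than the highest known
one. -/
theorem Guards.handle {σ : Config Tx Client Res n} {r : Fin n} {B P : Block Tx}
    (hP : Guards σ r P) : Guards (next client exec σ (.handle r B)) r P := by
  refine ⟨?_, ?_⟩
  · simpa [next] using hP.1.trans (le_highAfter_view (σ.loc r) B).1
  · rintro A (hA | ⟨hA, hvote⟩) hPA
    · exact hP.2 A hA hPA
    · obtain rfl : A = B := by simpa using hA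
      exact hP.1.trans hvote

theorem Guards.propose {σ : Config Tx Client Res n} {r : Fin n} {B P : Block Tx}
    (hP : Guards σ r P) (h : Allowed f faulty Δ startTime σ t (.propose r B)) :
    Guards (next client exec σ (.propose r B)) r P := by
  refine ⟨?_, ?_⟩
  · simpa [next] using hP.1.trans (h.2.2.2.2.2 _ (Or.inl rfl))
  · simpa [next] using hP.2

theorem ReplicaInv.enterView {σ : Config Tx Client Res n} {r : Fin n} {v : ℕ}
    (I : ReplicaInv f σ r)
    (h : ((σ.loc r).view = v ∧ (σ.loc r).active = false) ∨ (σ.loc r).view < v) :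
    ReplicaInv f (next client exec σ (.enterView r v)) r := by
  have hle : (σ.loc r).view ≤ v := by omega
  constructor <;> simp only [next, Function.update_self]
  · exact fun B hB => (I.signed_view B hB).trans_le hle
  · exact I.signed_parent
  · exact I.signed_unique
  · intro C hC hv
    simpa [Guards] using I.signed_guards C hC hv
  · exact I.high_certified
  · exact I.high_view.trans (by omega)
  · intro d v' h' o hm
    obtain ⟨h1, h2⟩ := I.newView_sent d v' h' o hm
    exact ⟨h1.trans hle, h2⟩
  · intro d h' o hm
    have h1 := (I.newView_sent d v h' o hm).1
    obtain rfl : (σ.loc r).view = v := by omega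
    exact I.newView_high d h' o hm
  · exact I.newView_unique
  · simp
  · intro d B hm
    obtain ⟨h1, h2, h3⟩ := I.propose_sent d B hm
    exact ⟨h1, h2.trans hle, h3⟩
  · intro d B hm hv
    have h1 := (I.propose_sent d B hm).2.1
    have h2 := I.propose_current d B hm (by omega)
    rcases h with h | h
    · simp [h.2] at h2
    · omega
  · exact I.propose_unique
  · exact I.ledger
  · intro c p hp
    simpa [Guards, Commits, Certified] using I.replies c p hp

theorem ReplicaInv.timeout {σ : Config Tx Client Res n} {r : Fin n} (I : ReplicaInv f σ r) :
    ReplicaInv f (next client exec σ (.timeout r)) r := by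
  have hh := I.high_view
  constructor <;> simp only [next, Function.update_self, Set.mem_insert_iff, Prod.mk.injEq,
    true_and, reduceCtorEq, and_false, false_or, Msg.newView.injEq]
  · exact fun B hB => (I.signed_view B hB).trans (Nat.lt_succ_self _)
  · exact I.signed_parent
  · exact I.signed_unique
  · intro C hC hv
    simpa [Guards] using I.signed_guards C hC hv
  · exact I.high_certified
  · omega
  · rintro d v' h' o (⟨-, rfl, rfl, rfl⟩ | hm)
    · exact ⟨le_rfl, by omega, I.high_certified, by simp⟩
    · obtain ⟨h1, h2⟩ := I.newView_sent d v' h' o hm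
      exact ⟨h1.trans (Nat.le_succ _), h2⟩
  · rintro d h' o (⟨-, rfl, rfl⟩ | hm)
    · exact Or.inl rfl
    · have := (I.newView_sent _ _ _ _ hm).1
      omega
  · rintro d d' v h h' o o' (⟨-, rfl, rfl, rfl⟩ | hm) (⟨-, h1, rfl, rfl⟩ | hm')
    · exact ⟨rfl, rfl⟩
    · have := (I.newView_sent _ _ _ _ hm').1
      omega
    · have := (I.newView_sent _ _ _ _ hm).1
      omega
    · exact I.newView_unique _ _ _ _ _ _ _ hm hm'
  · exact fun _ => ⟨_, _, Or.inl ⟨rfl, rfl⟩⟩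
  · intro d B hm
    obtain ⟨h1, h2, h3⟩ := I.propose_sent d B hm
    exact ⟨h1, h2.trans (Nat.le_succ _), h3⟩
  · intro d B hm hv
    have h1 := (I.propose_sent d B hm).2.1
    omega
  · exact I.propose_unique
  · exact I.ledger
  · intro c p hp
    simpa [Guards, Commits, Certified] using I.replies c p hp

theorem ReplicaInv.propose {σ : Config Tx Client Res n} {r : Fin n} {B : Block Tx}
    (I : ReplicaInv f σ r) (h : Allowed f faulty Δ startTime σ t (.propose r B)) :
    ReplicaInv f (next client exec σ (.propose r B)) r := by
  obtain ⟨-, ⟨hl, ha, hp, -⟩, -, ⟨ts, P, rfl⟩, hk, hmax⟩ := h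
  have hhigh := hmax _ (Or.inl rfl)
  have hv := hk.view_le I
  have hc := hk.certified I
  simp only [Block.parent] at hhigh hv hc
  have hg : ∀ Q, Guards σ r Q → Q.view ≤ P.view ∧
      ∀ A, (r, A) ∈ σ.signed → Q.view < A.view → Q.view ≤ A.parent.view :=
    fun Q hQ => ⟨hQ.1.trans hhigh, hQ.2⟩
  have hnew : ∀ d A, (r, d, Msg.propose A) ∈ σ.sent → A.view ≠ (σ.loc r).view := by
    intro d A hA hv
    have := (I.propose_current d A hA hv).2.1
    simp [hp] at this
  constructor <;> simp only [next, Function.update_self, Set.mem_union, Set.mem_ofPred_eq,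
    Prod.mk.injEq, true_and, reduceCtorEq, and_false, exists_false, or_false, Block.parent,
    Msg.propose.injEq, Guards]
  · exact I.signed_view
  · exact I.signed_parent
  · exact I.signed_unique
  · exact fun C hC hv => hg _ (I.signed_guards C hC hv)
  · exact hc
  · exact hv
  · exact I.newView_sent
  · exact fun d h o hm => Or.inr ⟨r, _, Or.inr ⟨r, rfl, rfl⟩, rfl⟩
  · exact I.newView_unique
  · simp [ha]
  · rintro d B (hm | ⟨_, -, rfl⟩)
    · exact I.propose_sent d B hm
    · exact ⟨hl, le_rfl, hc, hv⟩
  · rintro d B (hm | ⟨_, -, rfl⟩) hv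
    · exact absurd hv (hnew d B hm)
    · exact ⟨ha, rfl⟩
  · rintro d d' A B (hm | ⟨_, -, rfl⟩) (hm' | ⟨_, -, rfl⟩) hv
    · exact I.propose_unique _ _ _ _ hm hm' hv
    · exact absurd hv (hnew d A hm)
    · exact absurd hv.symm (hnew d' B hm')
    · rfl
  · exact I.ledger
  · intro c p hp
    rcases I.replies c p hp with h1 | ⟨h1, h2⟩
    · exact Or.inl h1
    · exact Or.inr ⟨h1, hg _ h2⟩

theorem ReplicaInv.handle {σ : Config Tx Client Res n} {r : Fin n} {B : Block Tx}
    (I : ReplicaInv f σ r) (h : CanHandle f σ r B) :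
    ReplicaInv f (next client exec σ (.handle r B)) r := by
  obtain ⟨-, hv, -, hc, hpv⟩ := h
  have hs := signed_subset_next (client := client) (exec := exec) σ (.handle r B)
  have hle := le_highAfter_view (σ.loc r) B
  have hhc : Certified f σ (highAfter (σ.loc r) B) ∧
      (highAfter (σ.loc r) B).view ≤ (σ.loc r).view := by
    unfold highAfter
    split_ifs
    · exact ⟨hc, by omega⟩
    · exact ⟨I.high_certified, I.high_view.trans (Nat.sub_le _ _)⟩
  -- A certificate of the preceding view is guarded once the proposal with it is processed: all
  -- proposals signed before have a lower view.
  have hnew : B.parent.view + 1 = B.view →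
      Guards (next client exec σ (.handle r B)) r B.parent := by
    intro hgap
    refine ⟨?_, ?_⟩
    · simpa [next] using hle.2
    · rintro A (hA | ⟨hA, -⟩) hPA
      · have := I.signed_view A hA
        omega
      · obtain rfl : A = B := by simpa using hA
        exact le_rfl
  have hcommit : ∀ A, A ∈ newlyCommitted (σ.loc r) B →
      ∃ C, Commits f (next client exec σ (.handle r B)) C ∧ A ∈ C.parent.chain := by
    intro A hA
    have := mem_newlyCommitted hA
    exact ⟨B.parent, ⟨hc.mono hs, this.1⟩, this.2⟩
  constructor
  · rintro A (hA | ⟨hA, -⟩)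
    · have := I.signed_view A hA
      simp only [next, Function.update_self]
      omega
    · obtain rfl : A = B := by simpa using hA
      simp only [next, Function.update_self]
      omega
  · rintro A (hA | ⟨hA, -⟩)
    · exact ⟨(I.signed_parent A hA).1, (I.signed_parent A hA).2.mono hs⟩
    · obtain rfl : A = B := by simpa using hA
      exact ⟨hpv, hc.mono hs⟩
  · rintro A A' (hA | ⟨hA, -⟩) (hA' | ⟨hA', -⟩) hAA
    · exact I.signed_unique A A' hA hA' hAA
    · obtain rfl : A' = B := by simpa using hA'
      have := I.signed_view A hA
      omega
    · obtain rfl : A = B := by simpa using hA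
      have := I.signed_view A' hA'
      omega
    · simp only [Prod.mk.injEq, true_and] at hA hA'
      rw [hA, hA']
  · rintro C (hC | ⟨hC, -⟩) hgap
    · exact (I.signed_guards C hC hgap).handle
    · obtain rfl : C = B := by simpa using hC
      exact hnew hgap
  · simpa [next] using hhc.1.mono hs
  · simpa [next] using hhc.2
  · rintro d v' h' o (hm | hm)
    · simp only [Prod.mk.injEq, Msg.newView.injEq, true_and] at hm
      obtain ⟨-, rfl, rfl, rfl⟩ := hm
      refine ⟨by simp [next], by omega, hhc.1.mono hs, ?_⟩
      intro A hA
      unfold shareAfter at hA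
      split_ifs at hA with hvote
      obtain rfl : B = A := by simpa using hA
      exact ⟨Or.inr ⟨rfl, hvote⟩, by omega⟩
    · obtain ⟨h1, h2, h3, h4⟩ := I.newView_sent d v' h' o hm
      refine ⟨?_, h2, h3.mono hs, fun A hA => ⟨hs (h4 A hA).1, (h4 A hA).2⟩⟩
      simp only [next, Function.update_self]
      omega
  · rintro d h' o (hm | hm)
    · simp only [Prod.mk.injEq, Msg.newView.injEq] at hm
      simp [next, hm.2.2.2.1]
    · have := (I.newView_sent _ _ _ _ hm).1
      simp only [next, Function.update_self] at this
      omega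
  · simp only [next, Set.mem_insert_iff, Prod.mk.injEq, Msg.newView.injEq, true_and]
    rintro d d' v h h' o o' (⟨-, rfl, rfl, rfl⟩ | hm) (⟨-, h1, rfl, rfl⟩ | hm')
    · exact ⟨rfl, rfl⟩
    · have := (I.newView_sent _ _ _ _ hm').1
      omega
    · have := (I.newView_sent _ _ _ _ hm).1
      omega
    · exact I.newView_unique _ _ _ _ _ _ _ hm hm'
  · exact fun _ => ⟨highAfter (σ.loc r) B, shareAfter (σ.loc r) B, by simp [next]⟩
  · rintro d A (hm | hm)
    · simp at hm
    · obtain ⟨h1, h2, h3, h4⟩ := I.propose_sent d A hm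
      refine ⟨h1, ?_, h3.mono hs, h4⟩
      simp only [next, Function.update_self]
      omega
  · rintro d A (hm | hm) hvA
    · simp at hm
    · have h1 := (I.propose_sent d A hm).2.1
      simp only [next, Function.update_self] at hvA
      omega
  · simp only [next, Set.mem_insert_iff, Prod.mk.injEq, reduceCtorEq, and_false, false_or]
    exact I.propose_unique
  · intro A hA
    simp only [next, Function.update_self, ledgerAfter, List.mem_append] at hA
    rcases hA with hA | hA
    · rcases I.ledger A hA with h1 | ⟨C, h1, h2⟩
      · exact Or.inl h1
      · exact Or.inr ⟨C, h1.mono hs, h2⟩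
    · exact Or.inr (hcommit A hA)
  · rintro c p (hp | ⟨-, ⟨A, hA, pre, T, post, -, hx⟩ | ⟨hspec, pre, T, post, -, hx⟩⟩)
    · rcases I.replies c p hp with ⟨C, h1, h2⟩ | ⟨h1, h2⟩
      · exact Or.inl ⟨C, h1.mono hs, h2⟩
      · exact Or.inr ⟨h1.mono hs, h2.handle⟩
    · obtain ⟨rfl, rfl⟩ := Prod.mk.inj hx
      exact Or.inl (hcommit A hA)
    · obtain ⟨rfl, rfl⟩ := Prod.mk.inj hx
      exact Or.inr ⟨hc.mono hs, hnew hspec.1⟩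

/-- An event either leaves the state of a correct replica alone, or is a step of that replica. -/
theorem sameFor_or_own_step {σ : Config Tx Client Res n} {a : Action Tx Client Res n} {r : Fin n}
    (hr : r ∉ faulty) (h : Allowed f faulty Δ startTime σ t a) :
    SameFor r σ (next client exec σ a) ∨ (∃ v, a = .enterView r v) ∨ a = .timeout r ∨
      (∃ B, a = .propose r B) ∨ ∃ B, a = .handle r B := by
  cases a with
  | idle => exact Or.inl (by constructor <;> simp [next])
  | clientReceive c s p => exact Or.inl (by constructor <;> simp [next])
  | deliver d s m =>
    left
    by_cases hd : r = d
    · subst hd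
      constructor <;> simp [next]
    · constructor <;> simp [next, hd]
  | faultySign q B =>
    left
    have hq : r ≠ q := fun e => hr (e ▸ h)
    constructor <;> simp [next, hq]
  | enterView q v =>
    by_cases hq : r = q
    · subst hq; simp
    · exact Or.inl (by constructor <;> simp [next, hq])
  | timeout q =>
    by_cases hq : r = q
    · subst hq; simp
    · exact Or.inl (by constructor <;> simp [next, hq])
  | propose q B =>
    by_cases hq : r = q
    · subst hq; simp
    · exact Or.inl (by constructor <;> simp [next, hq])
  | handle q B =>
    by_cases hq : r = q
    · subst hq; simp
    · exact Or.inl (by constructor <;> simp [next, hq])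

theorem ReplicaInv.next {σ : Config Tx Client Res n} {a : Action Tx Client Res n} {r : Fin n}
    (hr : r ∉ faulty) (h : Allowed f faulty Δ startTime σ t a) (I : ReplicaInv f σ r) :
    ReplicaInv f (next client exec σ a) r := by
  rcases sameFor_or_own_step (client := client) (exec := exec) hr h with
    hs | ⟨v, rfl⟩ | rfl | ⟨B, rfl⟩ | ⟨B, rfl⟩
  · exact hs.replicaInv (signed_subset_next σ a) I
  · exact I.enterView h.2
  · exact I.timeout
  · exact I.propose h
  · exact I.handle h.2

theorem Guards.next {σ : Config Tx Client Res n} {a : Action Tx Client Res n} {r : Fin n}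
    {P : Block Tx} (hr : r ∉ faulty) (h : Allowed f faulty Δ startTime σ t a)
    (hP : Guards σ r P) : Guards (next client exec σ a) r P := by
  rcases sameFor_or_own_step (client := client) (exec := exec) hr h with
    hs | ⟨v, rfl⟩ | rfl | ⟨B, rfl⟩ | ⟨B, rfl⟩
  · exact hs.guards.2 hP
  · simpa [HotStuff1.next, Guards] using hP
  · simpa [HotStuff1.next, Guards] using hP
  · exact hP.propose h
  · exact hP.handle

theorem replicaInv_initial (r : Fin n) :
    ReplicaInv f (initial : Config Tx Client Res n) r := by
  constructor <;> simp [initial, Certified, Block.view]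

end Step

/-! ### Quorums and locked blocks -/

section Quorums

variable {f : ℕ} {faulty : Finset (Fin n)}

theorem exists_correct_mem_inter (hn : 3 * f + 1 ≤ n) (hfaulty : faulty.card ≤ f)
    {S T : Set (Fin n)} (hS : n - f ≤ S.ncard) (hT : n - f ≤ T.ncard) :
    ∃ r ∉ faulty, r ∈ S ∧ r ∈ T := by
  by_contra! h
  have h1 : (S ∩ T).ncard ≤ (faulty : Set (Fin n)).ncard := by
    refine Set.ncard_le_ncard (fun r hr => ?_) (Set.toFinite _)
    by_contra hf
    exact h r hf hr.1 hr.2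
  have h2 := Set.ncard_union_add_ncard_inter S T
  have h3 : (S ∪ T).ncard ≤ n := by simpa using Set.ncard_le_card (S ∪ T)
  rw [Set.ncard_coe_finset] at h1
  omega

theorem le_ncard_correct (hfaulty : faulty.card ≤ f) {S : Set (Fin n)}
    (hS : ∀ r ∉ faulty, r ∈ S) : n - f ≤ S.ncard := by
  have h1 : ((faultyᶜ : Finset (Fin n)) : Set (Fin n)).ncard ≤ S.ncard :=
    Set.ncard_le_ncard (fun r hr => hS r (by simpa using hr)) (Set.toFinite _)
  rw [Set.ncard_coe_finset, Finset.card_compl, Fintype.card_fin] at h1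
  omega

theorem Certified.exists_correct_signer (hn : 3 * f + 1 ≤ n) (hfaulty : faulty.card ≤ f)
    {σ : Config Tx Client Res n} {B : Block Tx} (h : Certified f σ B) (hB : B ≠ Block.genesis) :
    ∃ r ∉ faulty, (r, B) ∈ σ.signed := by
  have h := h.resolve_left hB
  obtain ⟨r, hr, h, -⟩ := exists_correct_mem_inter hn hfaulty h h
  exact ⟨r, hr, h⟩

/-- `P` is certified, and every certified block of a higher view has `P` in its chain. -/
def Locked (f : ℕ) (σ : Config Tx Client Res n) (P : Block Tx) : Prop :=
  Certified f σ P ∧ ∀ D, Certified f σ D → P.view < D.view → P ∈ D.chain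

theorem locked_genesis {σ : Config Tx Client Res n} : Locked f σ Block.genesis :=
  ⟨Or.inl rfl, fun D _ _ => D.genesis_mem_chain⟩

end Quorums

section Safety

variable [NeZero n] {f : ℕ} {faulty : Finset (Fin n)} {σ : Config Tx Client Res n}

theorem Certified.parent (hn : 3 * f + 1 ≤ n) (hfaulty : faulty.card ≤ f)
    (I : ∀ r ∉ faulty, ReplicaInv f σ r) {B : Block Tx} (h : Certified f σ B)
    (hB : B ≠ Block.genesis) : Certified f σ B.parent ∧ B.parent.view < B.view := by
  obtain ⟨r, hr, hs⟩ := h.exists_correct_signer hn hfaulty hB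
  exact ((I r hr).signed_parent B hs).symm

theorem Certified.wellFormed (hn : 3 * f + 1 ≤ n) (hfaulty : faulty.card ≤ f)
    (I : ∀ r ∉ faulty, ReplicaInv f σ r) {B : Block Tx} (h : Certified f σ B) :
    B.WellFormed := by
  induction B with
  | genesis => trivial
  | node v ts p ih =>
    obtain ⟨h1, h2⟩ := h.parent hn hfaulty I (by simp)
    exact ⟨h2, ih h1⟩

/-- Two certified blocks of the same view are equal: a correct replica has signed both. -/
theorem Certified.eq_of_view_eq (hn : 3 * f + 1 ≤ n) (hfaulty : faulty.card ≤ f)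
    (I : ∀ r ∉ faulty, ReplicaInv f σ r) {A B : Block Tx} (hA : Certified f σ A)
    (hB : Certified f σ B) (h : A.view = B.view) : A = B := by
  by_cases hA' : A = Block.genesis <;> by_cases hB' : B = Block.genesis
  · rw [hA', hB']
  · have h0 : A.view = 0 := by rw [hA']; rfl
    have := (hB.parent hn hfaulty I hB').2
    omega
  · have h0 : B.view = 0 := by rw [hB']; rfl
    have := (hA.parent hn hfaulty I hA').2
    omega
  · obtain ⟨r, hr, h1, h2⟩ := exists_correct_mem_inter hn hfaulty
      (hA.resolve_left hA') (hB.resolve_left hB')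
    exact (I r hr).signed_unique A B h1 h2 h

/-- A certified block guarded by a quorum is locked: going down from a certified block of a higher
view, each certificate is extended by a guarding replica, so the views of the predecessors cannot
jump below that of `P`. -/
theorem locked_of_guards (hn : 3 * f + 1 ≤ n) (hfaulty : faulty.card ≤ f)
    (I : ∀ r ∉ faulty, ReplicaInv f σ r) {P : Block Tx} (hP : Certified f σ P)
    {S : Set (Fin n)} (hS : n - f ≤ S.ncard) (hg : ∀ r ∈ S, r ∉ faulty → Guards σ r P) :
    Locked f σ P := by
  refine ⟨hP, fun D => ?_⟩
  induction D with
  | genesis => intro _ h; simp [Block.view] at h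
  | node v ts p ih =>
    intro hD hv
    obtain ⟨r, hr, h1, h2⟩ := exists_correct_mem_inter hn hfaulty hS (hD.resolve_left (by simp))
    have hle := (hg r h1 hr).2 _ h2 hv
    have hp := (hD.parent hn hfaulty I (by simp)).1
    apply Block.mem_chain_of_mem_parent
    rcases hle.eq_or_lt with h | h
    · rw [hP.eq_of_view_eq hn hfaulty I hp h]
      exact Block.self_mem_chain _
    · exact ih hp h

theorem Commits.locked (hn : 3 * f + 1 ≤ n) (hfaulty : faulty.card ≤ f)
    (I : ∀ r ∉ faulty, ReplicaInv f σ r) {C : Block Tx} (h : Commits f σ C) :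
    Locked f σ C.parent := by
  have hC : C ≠ Block.genesis := by
    rintro rfl
    simpa [Block.view, Block.parent] using h.2
  exact locked_of_guards hn hfaulty I (h.1.parent hn hfaulty I hC).1 (h.1.resolve_left hC)
    fun r hr hf => (I r hf).signed_guards C hr h.2

theorem Locked.mem_chain (hn : 3 * f + 1 ≤ n) (hfaulty : faulty.card ≤ f)
    (I : ∀ r ∉ faulty, ReplicaInv f σ r) {P D : Block Tx} (hP : Locked f σ P)
    (hD : Certified f σ D) (hv : P.view ≤ D.view) : P ∈ D.chain := by
  rcases hv.eq_or_lt with h | h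
  · rw [hP.1.eq_of_view_eq hn hfaulty I hD h]
    exact Block.self_mem_chain _
  · exact hP.2 D hD h

/-- Blocks in the chains of locked blocks do not conflict. -/
theorem Locked.not_conflicts (hn : 3 * f + 1 ≤ n) (hfaulty : faulty.card ≤ f)
    (I : ∀ r ∉ faulty, ReplicaInv f σ r) {P Q A B : Block Tx} (hP : Locked f σ P)
    (hQ : Locked f σ Q) (hA : A ∈ P.chain) (hB : B ∈ Q.chain) : ¬ A.Conflicts B := by
  have key : A = B ∨ A.Extends B ∨ B.Extends A := by
    rcases le_total P.view Q.view with h | h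
    · exact (hQ.1.wellFormed hn hfaulty I).eq_or_extends
        (Block.mem_chain_trans hA (hP.mem_chain hn hfaulty I hQ.1 h)) hB
    · exact (hP.1.wellFormed hn hfaulty I).eq_or_extends hA
        (Block.mem_chain_trans hB (hQ.mem_chain hn hfaulty I hP.1 h))
  rintro ⟨h1, h2, h3⟩
  tauto

theorem ReplicaInv.exists_locked_of_committed (hn : 3 * f + 1 ≤ n) (hfaulty : faulty.card ≤ f)
    (I : ∀ r ∉ faulty, ReplicaInv f σ r) {r : Fin n} (hr : r ∉ faulty) {A : Block Tx}
    (hA : A ∈ (σ.loc r).globalLedger) : ∃ P, Locked f σ P ∧ A ∈ P.chain := by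
  rcases (I r hr).ledger A hA with rfl | ⟨C, hC, h⟩
  · exact ⟨_, locked_genesis, Block.self_mem_chain _⟩
  · exact ⟨_, hC.locked hn hfaulty I, h⟩

end Safety

/-! ### Executions -/

namespace Execution

variable [NeZero n] {f : ℕ} {faulty : Finset (Fin n)} {client : Tx → Client}
  {exec : List Tx → Res} {Δ : ℝ} (e : Execution f faulty client exec Δ)

theorem replicaInv (i : ℕ) : ∀ r ∉ faulty, ReplicaInv f (e.cfg i) r := by
  intro r hr
  induction i with
  | zero => rw [e.cfg_zero]; exact replicaInv_initial r
  | succ i ih => rw [e.cfg_succ]; exact ih.next hr (e.allowed i)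

theorem signed_mono : Monotone fun i => (e.cfg i).signed :=
  monotone_nat_of_le_succ fun i => by
    simp only [e.cfg_succ]
    exact signed_subset_next _ _

theorem sent_mono : Monotone fun i => (e.cfg i).sent :=
  monotone_nat_of_le_succ fun i => by
    simp only [e.cfg_succ]
    cases e.act i <;> simp [next]

theorem replies_mono : Monotone fun i => (e.cfg i).replies :=
  monotone_nat_of_le_succ fun i => by
    simp only [e.cfg_succ]
    cases e.act i <;> simp [next]

theorem inbox_mono (r : Fin n) : Monotone fun i => ((e.cfg i).loc r).inbox :=
  monotone_nat_of_le_succ fun i => by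
    simp only [e.cfg_succ]
    cases e.act i <;> simp only [next, Function.update_apply] <;> try split_ifs
    all_goals try subst r
    all_goals simp

theorem globalLedger_mono (r : Fin n) {i j : ℕ} (hij : i ≤ j) {A : Block Tx}
    (h : A ∈ ((e.cfg i).loc r).globalLedger) : A ∈ ((e.cfg j).loc r).globalLedger := by
  induction j, hij using Nat.le_induction with
  | base => exact h
  | succ j _ ih =>
    rw [e.cfg_succ]
    cases e.act j <;> simp only [next, Function.update_apply] <;> try split_ifs
    all_goals try subst r
    all_goals simp [ledgerAfter, ih]

theorem guards_mono {r : Fin n} (hr : r ∉ faulty) {i j : ℕ} (hij : i ≤ j) {P : Block Tx}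
    (h : Guards (e.cfg i) r P) : Guards (e.cfg j) r P := by
  induction j, hij using Nat.le_induction with
  | base => exact h
  | succ j _ ih => rw [e.cfg_succ]; exact ih.next hr (e.allowed j)

/-- Messages of correct replicas are not forged. -/
theorem sent_of_mem_inbox {s : Fin n} (hs : s ∉ faulty) {i : ℕ} {d : Fin n} {m : Msg Tx}
    (h : (s, m) ∈ ((e.cfg i).loc d).inbox) : ∃ d', (s, d', m) ∈ (e.cfg i).sent := by
  induction i with
  | zero => simp [e.cfg_zero, initial] at h
  | succ i ih =>
    have hmono := e.sent_mono (Nat.le_succ i)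
    by_cases hold : (s, m) ∈ ((e.cfg i).loc d).inbox
    · obtain ⟨d', h'⟩ := ih hold
      exact ⟨d', hmono h'⟩
    · have ha := e.allowed i
      rw [e.cfg_succ] at h
      cases hact : e.act i <;> rw [hact] at h ha <;>
        simp only [next, Function.update_apply] at h <;> try split_ifs at h
      all_goals try subst d
      all_goals try exact absurd h hold
      rcases h with h | h
      · obtain ⟨rfl, rfl⟩ := Prod.mk.inj h
        obtain ⟨d', h'⟩ := ha.resolve_left hs
        exact ⟨d', hmono h'⟩
      · exact absurd h hold

/-- A reply quorum for `B` puts `B` into the chain of a locked block: either a correct replica has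
committed `B`, or all correct replicas of the quorum have executed it speculatively, and guard it. -/
theorem exists_locked_of_receives (hn : 3 * f + 1 ≤ n) (hfaulty : faulty.card ≤ f)
    {c : Client} {p : Reply Tx Res} {Q : Finset (Fin n)} (hQ : n - f ≤ Q.card)
    (hresp : ∀ r ∈ Q, e.Receives c r p) :
    ∃ P, p.block ∈ P.chain ∧ ∃ m, ∀ i, m ≤ i → Locked f (e.cfg i) P := by
  have hQ' : n - f ≤ (Q : Set (Fin n)).ncard := by rwa [Set.ncard_coe_finset]
  have hrep : ∀ r, ∃ i, r ∈ Q → r ∉ faulty → (r, c, p) ∈ (e.cfg i).replies := by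
    intro r
    by_cases hr : r ∈ Q
    · obtain ⟨i, hi⟩ := hresp r hr
      have ha := e.allowed i
      rw [hi] at ha
      exact ⟨i, fun _ hf => ha.resolve_left hf⟩
    · exact ⟨0, fun h => absurd h hr⟩
  choose k hk using hrep
  have hr : ∀ r ∈ Q, r ∉ faulty → (r, c, p) ∈ (e.cfg (Finset.univ.sup k)).replies :=
    fun r hr hf => e.replies_mono (Finset.le_sup (Finset.mem_univ r)) (hk r hr hf)
  by_cases hcom : ∃ C, Commits f (e.cfg (Finset.univ.sup k)) C ∧ p.block ∈ C.parent.chain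
  · obtain ⟨C, hC, h⟩ := hcom
    exact ⟨_, h, _, fun i hi => (hC.mono (e.signed_mono hi)).locked hn hfaulty (e.replicaInv i)⟩
  · have hspec : ∀ r ∈ Q, r ∉ faulty → Certified f (e.cfg (Finset.univ.sup k)) p.block ∧
        Guards (e.cfg (Finset.univ.sup k)) r p.block :=
      fun r hrQ hf => ((e.replicaInv _ r hf).replies c p (hr r hrQ hf)).resolve_left hcom
    obtain ⟨r, hf, hrQ, -⟩ := exists_correct_mem_inter hn hfaulty hQ' hQ'
    exact ⟨p.block, Block.self_mem_chain _, _, fun i hi =>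
      locked_of_guards hn hfaulty (e.replicaInv i) ((hspec r hrQ hf).1.mono (e.signed_mono hi)) hQ'
        fun r hr hf => e.guards_mono hf hi (hspec r hr hf).2⟩

end Execution

/-! ### Progress in synchronized views -/

namespace Execution

variable [NeZero n] {f : ℕ} {faulty : Finset (Fin n)} {client : Tx → Client}
  {exec : List Tx → Res} {Δ τ GST : ℝ} {vs : ℕ} (e : Execution f faulty client exec Δ)

theorem lt_of_time_lt {i j : ℕ} (h : e.time i < e.time j) : i < j := by
  by_contra! hji
  exact (e.time_mono hji).not_gt h

theorem sent_of_act_propose {k : ℕ} {r : Fin n} {B : Block Tx} (h : e.act k = .propose r B)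
    (d : Fin n) {i : ℕ} (hi : k < i) : (r, d, Msg.propose B) ∈ (e.cfg i).sent := by
  refine e.sent_mono hi ?_
  simp [e.cfg_succ, h, next]

/-- Correct leaders do not equivocate. -/
theorem propose_unique {r : Fin n} (hr : r ∉ faulty) {i j : ℕ} {d d' : Fin n} {A B : Block Tx}
    (hA : (r, d, Msg.propose A) ∈ (e.cfg i).sent) (hB : (r, d', Msg.propose B) ∈ (e.cfg j).sent)
    (hv : A.view = B.view) : A = B :=
  (e.replicaInv (max i j) r hr).propose_unique d d' A B (e.sent_mono (le_max_left i j) hA)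
    (e.sent_mono (le_max_right i j) hB) hv

/-- A proposal of a correct leader that is being processed has been sent by it. -/
theorem sent_of_canHandle {q : Fin n} {i : ℕ} {B : Block Tx} (h : CanHandle f (e.cfg i) q B)
    (hL : leader B.view ∉ faulty) : ∃ d, (leader B.view, d, Msg.propose B) ∈ (e.cfg i).sent :=
  e.sent_of_mem_inbox hL h.2.2.1

theorem lt_of_act_propose_of_sent {k i : ℕ} {r d : Fin n} {B : Block Tx}
    (h : e.act k = .propose r B) (hs : (r, d, Msg.propose B) ∈ (e.cfg i).sent) : k < i := by
  by_contra! hik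
  have ha := e.allowed k
  rw [h] at ha
  obtain ⟨hr, ⟨-, -, hp, -⟩, -, ⟨ts, P, rfl⟩, -⟩ := ha
  have := ((e.replicaInv k r hr).propose_current d _ (e.sent_mono hik hs) rfl).2.1
  simp [hp] at this

theorem hasNewView_of_mem_inbox {r s : Fin n} (hs : s ∉ faulty) {i : ℕ} {h : Block Tx}
    {o : Option (Block Tx)}
    (hm : (s, Msg.newView ((e.cfg i).loc r).view h o) ∈ ((e.cfg i).loc r).inbox) :
    HasNewView f (e.cfg i) r s h o := by
  obtain ⟨d, hd⟩ := e.sent_of_mem_inbox hs hm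
  obtain ⟨-, h1, h2, -⟩ := (e.replicaInv i s hs).newView_sent _ _ _ _ hd
  exact ⟨hm, h2, h1⟩

variable {e}

/-- Every correct replica has sent its NewView message for view `v` before it enters `v`. -/
theorem Synchronized.exists_newView_sent (hV : e.Synchronized GST τ vs) {v : ℕ} (hv : vs < v)
    {r q : Fin n} (hr : r ∉ faulty) (hq : q ∉ faulty) :
    ∃ i h o, (q, leader v, Msg.newView v h o) ∈ (e.cfg i).sent ∧
      e.time i < e.startTime r v + 2 * Δ := by
  obtain ⟨i, hi, ht⟩ := hV.enter r hr q hq v hv.le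
  have hview := hV.no_skip q hq v hv i hi
  have ha := e.allowed i
  rw [hi] at ha
  have hact : ((e.cfg i).loc q).active = false := by
    rcases ha.2 with h | h
    · exact h.2
    · omega
  obtain ⟨h, o, hm⟩ := (e.replicaInv i q hq).inactive_sent hact
  rw [hview] at hm
  exact ⟨i, h, o, hm, ht⟩

theorem Synchronized.exists_newView_received (hsync : e.PartiallySynchronous GST)
    (hV : e.Synchronized GST τ vs) (hΔ : 0 < Δ) {v : ℕ} (hv : vs < v)
    (hL : leader v ∉ faulty) {q : Fin n} (hq : q ∉ faulty) :
    ∃ j h o, (q, Msg.newView v h o) ∈ ((e.cfg (j + 1)).loc (leader v)).inbox ∧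
      e.time j < e.startTime (leader v) v + 3 * Δ := by
  obtain ⟨i, h, o, hm, ht⟩ := hV.exists_newView_sent hv hL hq
  obtain ⟨j, hj, hjt⟩ := hsync i q hq _ hL _ (e.sent_mono (Nat.le_succ i) hm)
  refine ⟨j, h, o, by simp [e.cfg_succ, hj, next], ?_⟩
  have h1 := hV.after_GST _ hL v hv.le
  have h2 : max (e.time i) GST < e.startTime (leader v) v + 2 * Δ := max_lt ht (by linarith)
  linarith

/-- A leader of a synchronized view whose ShareTimer has expired has the NewView messages of all
correct replicas. -/
theorem Synchronized.hasNewView_of_timer (hsync : e.PartiallySynchronous GST)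
    (hV : e.Synchronized GST τ vs) (hΔ : 0 < Δ) {v : ℕ} (hv : vs < v)
    (hL : leader v ∉ faulty) {k : ℕ} (hk : e.startTime (leader v) v + 3 * Δ ≤ e.time k)
    {i : ℕ} (hi : k ≤ i) (hview : ((e.cfg i).loc (leader v)).view = v) {q : Fin n}
    (hq : q ∉ faulty) : ∃ h o, HasNewView f (e.cfg i) (leader v) q h o := by
  obtain ⟨j, h, o, hm, hj⟩ := hV.exists_newView_received hsync hΔ hv hL hq
  have hjk : j + 1 ≤ i := (e.lt_of_time_lt (hj.trans_le hk)).trans_le hi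
  refine ⟨h, o, e.hasNewView_of_mem_inbox hq ?_⟩
  rw [hview]
  exact e.inbox_mono _ hjk hm

/-- In a synchronized view, a correct replica remains active until its timer expires, unless it
processes a proposal. -/
theorem Synchronized.step (hV : e.Synchronized GST τ vs) {v : ℕ} (hv : vs < v)
    {r q : Fin n} (hr : r ∉ faulty) (hq : q ∉ faulty) {i : ℕ}
    (hview : ((e.cfg i).loc q).view = v) (hact : ((e.cfg i).loc q).active = true)
    (ht : e.time i < e.startTime r v + τ - 2 * Δ) :
    (∃ B, e.act i = .handle q B) ∨
      ((e.cfg (i + 1)).loc q).view = v ∧ ((e.cfg (i + 1)).loc q).active = true ∧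
        ((∃ B, e.act i = .propose q B) ∨
          ((e.cfg (i + 1)).loc q).proposed = ((e.cfg i).loc q).proposed) := by
  have ha := e.allowed i
  rcases sameFor_or_own_step (client := client) (exec := exec) hq ha with
    hs | ⟨w, h⟩ | h | ⟨B, h⟩ | ⟨B, h⟩
  · rw [← e.cfg_succ] at hs
    exact Or.inr ⟨hs.view.trans hview, hs.active.trans hact, Or.inr hs.proposed⟩
  · rw [h] at ha
    rcases ha.2 with h' | h'
    · simp [h'.2] at hact
    · have := hV.no_skip q hq w (by omega) i h
      omega
  · exact absurd (hV.timeout r hr q hq v hv.le i h hview) (not_le.2 ht)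
  · right
    rw [e.cfg_succ, h]
    refine ⟨?_, ?_, Or.inl ⟨B, rfl⟩⟩ <;> simpa [next]
  · exact Or.inl ⟨B, h⟩

/-- A correct leader of a synchronized view proposes when its ShareTimer expires, or before. -/
theorem Synchronized.exists_propose (hsync : e.PartiallySynchronous GST)
    (hV : e.Synchronized GST τ vs) (hΔ : 0 < Δ) (hτ : 6 * Δ < τ) (hfaulty : faulty.card ≤ f)
    {v : ℕ} (hv : vs < v) (hL : leader v ∉ faulty) :
    ∃ k B, e.act k = .propose (leader v) B ∧ B.view = v ∧
      e.time k ≤ e.startTime (leader v) v + 3 * Δ := by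
  classical
  by_contra! hno
  obtain ⟨i₀, hi₀, ht₀⟩ := hV.enter _ hL _ hL v hv.le
  have hstay : ∀ j, i₀ ≤ j → e.time j ≤ e.startTime (leader v) v + 3 * Δ →
      ((e.cfg (j + 1)).loc (leader v)).view = v ∧
        ((e.cfg (j + 1)).loc (leader v)).active = true ∧
        ((e.cfg (j + 1)).loc (leader v)).proposed = false := by
    intro j hj
    induction j, hj using Nat.le_induction with
    | base => intro _; simp [e.cfg_succ, hi₀, next]
    | succ j hj ih =>
      intro ht
      obtain ⟨h1, h2, h3⟩ := ih ((e.time_mono (Nat.le_succ j)).trans ht)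
      rcases hV.step hv hL hL h1 h2 (by linarith) with ⟨B, hB⟩ | ⟨h4, h5, ⟨B, hB⟩ | h6⟩
      · have ha := e.allowed (j + 1)
        rw [hB] at ha
        have hBv : B.view = v := ha.2.2.1.symm.trans h1
        obtain ⟨d, hd⟩ := e.sent_of_canHandle ha.2 (by rwa [hBv])
        rw [hBv] at hd
        have := ((e.replicaInv (j + 1) _ hL).propose_current d B hd (hBv.trans h1.symm)).2.1
        simp [h3] at this
      · have ha := e.allowed (j + 1)
        rw [hB] at ha
        obtain ⟨-, -, -, ⟨ts, P, rfl⟩, -⟩ := ha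
        exact absurd ht (not_le.2 (hno _ _ hB h1))
      · exact ⟨h4, h5, h6.trans h3⟩
  -- The last event before the ShareTimer expires: by then all NewView messages have arrived.
  have hex : ∃ K, e.startTime (leader v) v + 3 * Δ ≤ e.time K :=
    (e.time_unbounded.eventually_ge_atTop _).exists
  have hbefore : ∀ j, e.time j < e.startTime (leader v) v + 3 * Δ → j < Nat.find hex :=
    fun j hj => e.lt_of_time_lt (hj.trans_le (Nat.find_spec hex))
  have hi₀K := hbefore i₀ (by linarith)
  obtain ⟨M, hM⟩ : ∃ M, Nat.find hex = M + 1 := ⟨Nat.find hex - 1, by omega⟩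
  have hMt : e.time M < e.startTime (leader v) v + 3 * Δ :=
    not_le.1 (Nat.find_min hex (by omega))
  have hready : ∀ j, M ≤ j → e.time j ≤ e.startTime (leader v) v + 3 * Δ →
      LeaderReady f (e.cfg (j + 1)) (leader v) := by
    intro j hj ht
    obtain ⟨h1, h2, h3⟩ := hstay j (by omega) ht
    refine ⟨by rw [h1], h2, h3, le_ncard_correct hfaulty fun q hq => ?_⟩
    exact hV.hasNewView_of_timer hsync hΔ hv hL (Nat.find_spec hex) (by omega) h1 hq
  obtain ⟨j, hj, hjt, hn⟩ := e.propose_prompt M _ hL (hready M le_rfl hMt.le)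
  have hMv := (hstay M (by omega) hMt.le).1
  rw [hMv, max_eq_right hMt.le] at hjt
  exact hn ⟨hready j hj hjt, by rw [hMv, (hstay j (by omega) hjt).1]⟩

/-- All correct replicas process the proposal of a correct leader of a synchronized view. -/
theorem Synchronized.exists_handle (hsync : e.PartiallySynchronous GST)
    (hV : e.Synchronized GST τ vs) (hΔ : 0 < Δ) (hτ : 6 * Δ < τ)
    {v : ℕ} (hv : vs < v) (hL : leader v ∉ faulty) {k : ℕ} {B : Block Tx}
    (hk : e.act k = .propose (leader v) B) (hBv : B.view = v)
    (hkt : e.time k ≤ e.startTime (leader v) v + 3 * Δ) {q : Fin n} (hq : q ∉ faulty) :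
    ∃ i, e.act i = .handle q B := by
  by_contra! hno
  obtain ⟨i₀, hi₀, ht₀⟩ := hV.enter _ hL q hq v hv.le
  have hsent := e.sent_of_act_propose hk q (Nat.lt_succ_self k)
  obtain ⟨j₀, hj₀, hjt⟩ := hsync k _ hL q hq _ hsent
  have hGST := hV.after_GST _ hL v hv.le
  have hjt' : e.time j₀ ≤ e.startTime (leader v) v + 4 * Δ := by
    have : max (e.time k) GST ≤ e.startTime (leader v) v + 3 * Δ := max_le hkt (by linarith)
    linarith
  have hstay : ∀ j, i₀ ≤ j → e.time j ≤ e.startTime (leader v) v + 4 * Δ →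
      ((e.cfg (j + 1)).loc q).view = v ∧ ((e.cfg (j + 1)).loc q).active = true := by
    intro j hj
    induction j, hj using Nat.le_induction with
    | base => intro _; simp [e.cfg_succ, hi₀, next]
    | succ j hj ih =>
      intro ht
      obtain ⟨h1, h2⟩ := ih ((e.time_mono (Nat.le_succ j)).trans ht)
      rcases hV.step hv hL hq h1 h2 (by linarith) with ⟨A, hA⟩ | ⟨h4, h5, -⟩
      · have ha := e.allowed (j + 1)
        rw [hA] at ha
        have hAv : A.view = v := ha.2.2.1.symm.trans h1
        obtain ⟨d, hd⟩ := e.sent_of_canHandle ha.2 (by rwa [hAv])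
        rw [hAv] at hd
        obtain rfl := e.propose_unique hL hd hsent (hAv.trans hBv.symm)
        exact absurd hA (hno _)
      · exact ⟨h4, h5⟩
  have hM : e.time (max i₀ j₀) ≤ e.startTime (leader v) v + 4 * Δ := by
    rcases max_choice i₀ j₀ with h | h <;> rw [h]
    · linarith
    · exact hjt'
  have hcan : ∀ j, max i₀ j₀ ≤ j → e.time j ≤ e.startTime (leader v) v + 4 * Δ →
      CanHandle f (e.cfg (j + 1)) q B := by
    intro j hj ht
    obtain ⟨h1, h2⟩ := hstay j ((le_max_left _ _).trans hj) ht
    have hin : (leader v, Msg.propose B) ∈ ((e.cfg (j + 1)).loc q).inbox := by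
      refine e.inbox_mono q (Nat.succ_le_succ ((le_max_right i₀ j₀).trans hj)) ?_
      simp [e.cfg_succ, hj₀, next]
    obtain ⟨d, hd⟩ := e.sent_of_mem_inbox hL hin
    obtain ⟨-, -, h3, h4⟩ := (e.replicaInv _ _ hL).propose_sent d B hd
    exact ⟨h2, h1.trans hBv.symm, by rwa [hBv], h3, by omega⟩
  obtain ⟨j, hj, hjt, hn⟩ := e.handle_prompt _ q hq B (hcan _ le_rfl hM)
  exact hn (hcan j hj (hjt.le.trans hM))

/-- When a correct leader of a synchronized view proposes, it can form a certificate of the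
preceding view, or it has the NewView messages of all correct replicas. -/
theorem Synchronized.forms_or_hasNewView (hsync : e.PartiallySynchronous GST)
    (hV : e.Synchronized GST τ vs) (hΔ : 0 < Δ) {v : ℕ} (hv : vs < v)
    {k : ℕ} {B : Block Tx} (hk : e.act k = .propose (leader v) B) (hBv : B.view = v) :
    (∃ A, Forms f (e.cfg k) (leader v) A) ∨
      ∀ q ∉ faulty, ∃ h o, HasNewView f (e.cfg k) (leader v) q h o := by
  have ha := e.allowed k
  rw [hk] at ha
  obtain ⟨hL, -, h, ⟨ts, P, rfl⟩, -⟩ := ha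
  have hBv : ((e.cfg k).loc (leader v)).view = v := hBv
  rcases h with h | h | h
  · exact Or.inl h
  · right
    intro q _
    have huniv : newViewSenders f (e.cfg k) (leader v) = Set.univ := by
      refine Set.eq_of_subset_of_ncard_le (Set.subset_univ _) ?_ (Set.toFinite _)
      rw [h, Set.ncard_univ, Nat.card_eq_fintype_card, Fintype.card_fin]
    have hmem : q ∈ newViewSenders f (e.cfg k) (leader v) := huniv ▸ Set.mem_univ q
    exact hmem
  · rw [hBv] at h
    exact Or.inr fun q hq => hV.hasNewView_of_timer hsync hΔ hv hL h le_rfl hBv hq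

/-- All correct replicas vote for the proposal of a correct leader of a synchronized view: its
certificate is of the preceding view, or not lower than any that a correct replica has reported. -/
theorem Synchronized.votes (hsync : e.PartiallySynchronous GST)
    (hV : e.Synchronized GST τ vs) (hΔ : 0 < Δ) {v : ℕ} (hv : vs < v)
    {k : ℕ} {B : Block Tx} (hk : e.act k = .propose (leader v) B) (hBv : B.view = v)
    {q : Fin n} {i : ℕ} (hi : e.act i = .handle q B) : Votes ((e.cfg i).loc q) B := by
  have ha := e.allowed k
  rw [hk] at ha
  obtain ⟨hL, -, -, ⟨ts, P, hB⟩, -, hmax⟩ := ha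
  have hview : ((e.cfg k).loc (leader v)).view = v := by
    rw [hB] at hBv
    exact hBv
  have ha := e.allowed i
  rw [hi] at ha
  obtain ⟨hq, hcan⟩ := ha
  have hqv : ((e.cfg i).loc q).view = v := hcan.2.1.trans hBv
  have I := e.replicaInv i q hq
  obtain ⟨d, hd⟩ := e.sent_of_canHandle hcan (by rwa [hBv])
  rw [hBv] at hd
  have hki := e.lt_of_act_propose_of_sent hk hd
  unfold Votes
  rcases hV.forms_or_hasNewView hsync hΔ hv hk hBv with ⟨A, hA⟩ | hall
  · have h1 := hmax A (Or.inr (Or.inr hA))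
    have h2 := hA.1
    have h3 := I.high_view
    omega
  · obtain ⟨h, o, hm⟩ := hall q hq
    have hle := hmax h (Or.inr (Or.inl ⟨q, o, hm⟩))
    obtain ⟨d', hd'⟩ := e.sent_of_mem_inbox hq hm.1
    rw [hview, ← hqv] at hd'
    rcases I.newView_high d' h o (e.sent_mono hki.le hd') with hh | ⟨d'', A, hA, hAv⟩
    · rwa [hh]
    · -- Here `q` is the leader of the view, and `A = B` is its own proposal.
      have hlead := (I.propose_sent d'' A hA).1
      have hAv' : A.view = v := hAv.trans hqv
      have hql : q = leader v := by rw [hlead, hAv']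
      have hhigh := (I.propose_current d'' A hA hAv).2.2
      rw [hql] at hA
      obtain rfl := e.propose_unique hL hA hd (hAv'.trans hBv.symm)
      rw [hhigh]

/-- In a synchronized view with a correct leader, the leader proposes, and all correct replicas
vote for its proposal. -/
theorem Synchronized.exists_voted (hsync : e.PartiallySynchronous GST)
    (hV : e.Synchronized GST τ vs) (hΔ : 0 < Δ) (hτ : 6 * Δ < τ) (hfaulty : faulty.card ≤ f)
    {v : ℕ} (hv : vs < v) (hL : leader v ∉ faulty) :
    ∃ k B, e.act k = .propose (leader v) B ∧ B.view = v ∧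
      ∀ q ∉ faulty, ∃ i, e.act i = .handle q B ∧ Votes ((e.cfg i).loc q) B := by
  obtain ⟨k, B, hk, hBv, hkt⟩ := hV.exists_propose hsync hΔ hτ hfaulty hv hL
  refine ⟨k, B, hk, hBv, fun q hq => ?_⟩
  obtain ⟨i, hi⟩ := hV.exists_handle hsync hΔ hτ hv hL hk hBv hkt hq
  exact ⟨i, hi, hV.votes hsync hΔ hv hk hBv hi⟩

theorem signed_of_votes {q : Fin n} {i : ℕ} {B : Block Tx} (hi : e.act i = .handle q B)
    (hvote : Votes ((e.cfg i).loc q) B) : (q, B) ∈ (e.cfg (i + 1)).signed := by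
  rw [e.cfg_succ, hi]
  exact Or.inr ⟨rfl, hvote⟩

theorem newView_of_votes {q : Fin n} {i : ℕ} {B : Block Tx} (hi : e.act i = .handle q B)
    (hvote : Votes ((e.cfg i).loc q) B) :
    (q, leader (B.view + 1), Msg.newView (B.view + 1) B.parent (some B)) ∈
      (e.cfg (i + 1)).sent := by
  have ha := e.allowed i
  rw [hi] at ha
  rw [e.cfg_succ, hi]
  left
  simp [highAfter, shareAfter, hvote, ha.2.2.1]

/-- A proposal that all correct replicas vote for is extended by the proposal of the next view, if
its leader is correct. -/
theorem Synchronized.parent_eq (hsync : e.PartiallySynchronous GST)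
    (hV : e.Synchronized GST τ vs) (hΔ : 0 < Δ) (hn : 3 * f + 1 ≤ n)
    (hfaulty : faulty.card ≤ f) {v : ℕ} (hv : vs < v) {A B : Block Tx} (hAv : A.view = v)
    (hA : ∀ q ∉ faulty, ∃ i, e.act i = .handle q A ∧ Votes ((e.cfg i).loc q) A)
    {k : ℕ} (hk : e.act k = .propose (leader (v + 1)) B) (hBv : B.view = v + 1) :
    B.parent = A := by
  have hall := hV.forms_or_hasNewView hsync hΔ (hv.trans (Nat.lt_add_one v)) hk hBv
  have ha := e.allowed k
  rw [hk] at ha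
  obtain ⟨hL, -, -, ⟨ts, P, hB⟩, hknow, hmax⟩ := ha
  have hview : ((e.cfg k).loc (leader (v + 1))).view = v + 1 := by
    rw [hB] at hBv
    exact hBv
  have I := e.replicaInv k _ hL
  have hle := hknow.view_le I
  have hge : v ≤ B.parent.view := by
    rcases hall with ⟨D, hD⟩ | hall
    · have h1 := hmax D (Or.inr (Or.inr hD))
      have h2 := hD.1
      omega
    · -- The shares in the NewView messages of the correct replicas form a certificate of `A`.
      have hforms : Forms f (e.cfg k) (leader (v + 1)) A := by
        refine ⟨by omega, le_ncard_correct hfaulty fun q hq => ?_⟩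
        obtain ⟨h, o, hm⟩ := hall q hq
        obtain ⟨i, hi, hvote⟩ := hA q hq
        have hs := newView_of_votes hi hvote
        rw [hAv] at hs
        obtain ⟨d, hd⟩ := e.sent_of_mem_inbox hq hm.1
        have hd' := hd
        rw [hview] at hd'
        obtain ⟨-, rfl⟩ := (e.replicaInv (max (i + 1) k) q hq).newView_unique _ _ _ _ _ _ _
          (e.sent_mono (le_max_right _ _) hd') (e.sent_mono (le_max_left _ _) hs)
        exact ⟨⟨h, hm⟩, (((e.replicaInv k q hq).newView_sent _ _ _ _ hd).2.2.2 A rfl).1⟩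
      have := hmax A (Or.inr (Or.inr hforms))
      omega
  choose! i hi hvote using hA
  have hcertA : Certified f (e.cfg (max k (Finset.univ.sup i + 1))) A := by
    refine Or.inr (le_ncard_correct hfaulty fun q hq => ?_)
    refine e.signed_mono ?_ (signed_of_votes (hi q hq) (hvote q hq))
    exact (Nat.succ_le_succ (Finset.le_sup (Finset.mem_univ q))).trans (le_max_right _ _)
  have hcertB := (hknow.certified I).mono
    (e.signed_mono (le_max_left k (Finset.univ.sup i + 1)))
  exact hcertB.eq_of_view_eq hn hfaulty (e.replicaInv _) hcertA (by omega)

end Execution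

/-- Since less than a third of the replicas are faulty, some three successive leaders are
correct, in arbitrarily high views. -/
theorem exists_three_correct_leaders [NeZero n] {f : ℕ} {faulty : Finset (Fin n)}
    (hn : 3 * f + 1 ≤ n) (hfaulty : faulty.card ≤ f) (m : ℕ) :
    ∃ v, m < v ∧ leader v ∉ faulty ∧ leader (v + 1) ∉ faulty ∧ leader (v + 2) ∉ faulty := by
  by_contra! h
  have hlead : ∀ x a : ℕ, (leader (n := n) (x + a)) - Fin.ofNat n a = leader x := by
    intro x a
    rw [sub_eq_iff_eq_add]
    ext
    simp [leader, Fin.val_add]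
  have hsub : (Finset.univ : Finset (Fin n)) ⊆ faulty ∪ (faulty.image (· - Fin.ofNat n 1) ∪
      faulty.image (· - Fin.ofNat n 2)) := by
    intro r _
    -- Replica `r` leads a view above `m`.
    obtain ⟨v, hv, hr⟩ : ∃ v, m < v ∧ leader v = r := by
      refine ⟨r + n * (m + 1), ?_, ?_⟩
      · have := Nat.le_mul_of_pos_left (m + 1) (Nat.pos_of_neZero n)
        omega
      · ext
        simp [leader, Nat.mod_eq_of_lt r.2]
    simp only [Finset.mem_union, Finset.mem_image]
    by_cases h0 : leader v ∈ faulty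
    · exact Or.inl (hr ▸ h0)
    by_cases h1 : leader (v + 1) ∈ faulty
    · exact Or.inr (Or.inl ⟨_, h1, (hlead v 1).trans hr⟩)
    · exact Or.inr (Or.inr ⟨_, h v hv h0 h1, (hlead v 2).trans hr⟩)
  have h1 := Finset.card_le_card hsub
  have h2 := Finset.card_union_le faulty (faulty.image (· - Fin.ofNat n 1) ∪
      faulty.image (· - Fin.ofNat n 2))
  have h3 := Finset.card_union_le (faulty.image (· - Fin.ofNat n 1))
    (faulty.image (· - Fin.ofNat n 2))
  have h4 : (faulty.image (· - Fin.ofNat n 1)).card ≤ faulty.card := Finset.card_image_le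
  have h5 : (faulty.image (· - Fin.ofNat n 2)).card ≤ faulty.card := Finset.card_image_le
  rw [Finset.card_univ, Fintype.card_fin] at h1
  omega

namespace Execution

variable [NeZero n] {f : ℕ} {faulty : Finset (Fin n)} {client : Tx → Client}
  {exec : List Tx → Res} {Δ τ GST : ℝ} {vs : ℕ} {e : Execution f faulty client exec Δ}

theorem committed_of_handle {q : Fin n} {i : ℕ} {B A : Block Tx} (hi : e.act i = .handle q B)
    (hB : B.parent.parent.view + 1 = B.parent.view) (hA : A ∈ B.parent.parent.chain) :
    e.Committed (i + 1) q A := by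
  classical
  unfold Committed
  rw [e.cfg_succ, hi]
  simp only [next, Function.update_self, ledgerAfter, newlyCommitted, if_pos hB, List.mem_append,
    List.mem_filter, decide_eq_true_eq]
  tauto

/-- Liveness: the chain of some certified block above any given view is committed, for good, by all
correct replicas. -/
theorem Synchronized.exists_committed (hsync : e.PartiallySynchronous GST)
    (hV : e.Synchronized GST τ vs) (hΔ : 0 < Δ) (hτ : 6 * Δ < τ) (hn : 3 * f + 1 ≤ n)
    (hfaulty : faulty.card ≤ f) (m : ℕ) :
    ∃ i D, m < D.view ∧ Certified f (e.cfg i) D ∧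
      ∀ j, i ≤ j → ∀ q ∉ faulty, ∀ A ∈ D.chain, e.Committed j q A := by
  obtain ⟨v, hv, hL1, hL2, hL3⟩ := exists_three_correct_leaders hn hfaulty (max vs m)
  have hvs : vs < v := (le_max_left _ _).trans_lt hv
  obtain ⟨k1, B1, hk1, hv1, hB1⟩ := hV.exists_voted hsync hΔ hτ hfaulty hvs hL1
  obtain ⟨k2, B2, hk2, hv2, hB2⟩ :=
    hV.exists_voted hsync hΔ hτ hfaulty (v := v + 1) (by omega) hL2
  obtain ⟨k3, B3, hk3, hv3, hB3⟩ :=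
    hV.exists_voted hsync hΔ hτ hfaulty (v := v + 2) (by omega) hL3
  have h12 := hV.parent_eq hsync hΔ hn hfaulty hvs hv1 hB1 hk2 hv2
  have h23 := hV.parent_eq hsync hΔ hn hfaulty (by omega) hv2 hB2 hk3 hv3
  choose! i1 hi1 hvote1 using hB1
  choose! i3 hi3 hvote3 using hB3
  refine ⟨max (Finset.univ.sup i1 + 1) (Finset.univ.sup i3 + 1), B1,
    hv1 ▸ (le_max_right _ _).trans_lt hv, ?_, ?_⟩
  · refine Or.inr (le_ncard_correct hfaulty fun q hq => ?_)
    refine e.signed_mono ?_ (signed_of_votes (hi1 q hq) (hvote1 q hq))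
    exact (Nat.succ_le_succ (Finset.le_sup (Finset.mem_univ q))).trans (le_max_left _ _)
  · intro j hj q hq A hA
    have hij : i3 q + 1 ≤ j :=
      (Nat.succ_le_succ (Finset.le_sup (Finset.mem_univ q))).trans ((le_max_right _ _).trans hj)
    refine e.globalLedger_mono q hij (committed_of_handle (hi3 q hq) ?_ ?_)
    · rw [h23, h12, hv1, hv2]
    · rwa [h23, h12]

end Execution

end HotStuff1

theorem mainTheorem3 {Tx Client Res : Type*} {n f : ℕ} [NeZero n] (hn : 3 * f + 1 ≤ n)
    (faulty : Finset (Fin n)) (hfaulty : faulty.card ≤ f)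
    (client : Tx → Client) (exec : List Tx → Res)
    (Δ τ GST : ℝ) (hΔ : 0 < Δ) (hτ : 6 * Δ < τ)
    (e : HotStuff1.Execution f faulty client exec Δ)
    (hsync : e.PartiallySynchronous GST)
    (hviews : ∃ vs : ℕ, e.Synchronized GST τ vs)
    (c : Client) (B : HotStuff1.Block Tx) (T : Tx) (hT : T ∈ B.txs) (res : Res)
    (Q : Finset (Fin n)) (hQ : n - f ≤ Q.card)
    (hresp : ∀ r ∈ Q, e.Receives c r ⟨B, T, res⟩) :
    (∃ i, ∀ j, i ≤ j → ∀ r ∉ faulty, e.Committed j r B) ∧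
      ∀ i, ∀ r ∉ faulty, ∀ A, A.Conflicts B → ¬ e.Committed i r A := by
  obtain ⟨vs, hV⟩ := hviews
  obtain ⟨P, hBP, m, hP⟩ := e.exists_locked_of_receives hn hfaulty hQ hresp
  constructor
  · obtain ⟨i, D, hDv, hD, hcom⟩ := hV.exists_committed hsync hΔ hτ hn hfaulty P.view
    have hPD : P ∈ D.chain := (hP (max i m) (le_max_right _ _)).2 D
      (hD.mono (e.signed_mono (le_max_left i m))) hDv
    exact ⟨i, fun j hj r hr => hcom j hj r hr B (HotStuff1.Block.mem_chain_trans hBP hPD)⟩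
  · intro i r hr A hconf hA
    obtain ⟨P', hP', hAP'⟩ := HotStuff1.ReplicaInv.exists_locked_of_committed hn hfaulty
      (e.replicaInv _) hr (e.globalLedger_mono r (le_max_left i m) hA)
    exact hP'.not_conflicts hn hfaulty (e.replicaInv _) (hP _ (le_max_right _ _)) hAP' hBP hconf
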